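/- **Theorem (Euclidicity).** Let $\Theta$ be the complete Boolean algebra of things (join = juxtaposition, meet = superimposition, $0$ = the null thing); two things are *separated* if their meet is $0$ and *united* otherwise. Let $\Xi\subset\Theta\setminus\{0\}$ be the set of basic things: no basic thing is a proper part of another one, and every thing is made out of basic things by juxtapositions and superimpositions. Every basic thing $x$ has a partially ordered set of states and in it a proper history $h(x)$ with a local time, i.e. an order isomorphism $\tau_x:h(x)\to\mathbb R$. Any two basic things $x,y$ interact all along their histories: there is an order isomorphism $a_{xy}:h(x)\to h(y)$, where $a_{xy}(s)$ is the state from which on $y$ is modified by the action of $x$ that starts at $s$. The reflex action of $x$ that is reflected at $t\in h(y)$ starts at $\tau^0=\tau_x(a_{xy}^{-1}(t))$ and ends at $\tau^1=\tau_x(a_{yx}(t))$. A state $s\in h(x)$ is *simultaneous* with $t\in h(y)$ if $\tau_x(s)=\frac12(\tau^0+\tau^1)$, and then their *ontic distance* is $d(s,t)=\frac c2|\tau^1-\tau^0|$, where $c>0$ is a constant. Assume: 1. for any two separated basic things $x,y$ there is $\varepsilon>0$ such that $\tau^1-\tau^0\ge\varepsilon$ for all reflex actions of $x$ on $y$; between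 united basic things, and from a basic thing to itself, $\tau^1=\tau^0$ always; 2. simultaneity is transitive (hence an equivalence relation, each class of which contains exactly one state of every basic thing); 3. $d$ is a pseudometric on each class of simultaneous states. Fix a class $E_O$ of simultaneous states (ontic space), and write $d(x,y)$ for the distance between the states of the basic things $x$ and $y$ in $E_O$. An *ontic point* is a set $\xi$ of basic things any two of which are united and such that each basic thing outside $\xi$ is separated from some member of $\xi$. The ontic points form a metric space under $$d_G(\xi,\eta)=\sup_{x\in\xi,\;y\in\eta}d(x,y).$$ Let *geometric space* $E_G$ be the completion of this metric space, and write $d_G$ for its metric as well. Say that $q$ is between $p$ and $r$ if $p\ne q\ne r$ and $d_G(p,q)+d_G(q,r)=d_G(p,r)$. Let $D(p_1,\dots,p_k)$ be the Cayley–Menger determinant, i.e. the determinant of the $(k+1)\times(k+1)$ matrix that arises from $(d_G(p_i,p_j)^2)_{i,j}$ by adding a first row and a first column of ones with a $0$ in the corner. Assume that $E_G$ satisfies the following axioms of Blumenthal's metric axiomatization of Euclidean geometry: * (2) for any $p\ne r$ there is a point between $p$ and $r$; * (3) for any $p\ne q$ there is a point $r$ such that $q$ is between $p$ and $r$; * (5')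 there are three points that are not aligned (no one of their three distances is the sum of the other two); * (6') there are four non-coplanar points, i.e. points with $D(p_1,p_2,p_3,p_4)>0$; * (7) there is no fourth dimension, i.e. $D(p_1,\dots,p_5)=0$ for any five points. Then $E_G$ is Euclidean: it is isometric to Euclidean 3-space $\mathbb R^3$. -/

import Mathlib

universe u v

/-! ## Things, basic things, histories, actions

The things form a complete Boolean algebra: `⊔` is juxtaposition, `⊓` is superimposition,
`sSup T` is the aggregation of `T`, `⊥` is the null thing and `⊤` is the world. -/

/-- Two things are separated if their superimposition is the null thing. -/
def Separated {Θ : Type u} [CompleteBooleanAlgebra Θ] (x y : Θ) : Prop := x ⊓ y = ⊥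

/-- Two things are united if they are not separated. -/
def United {Θ : Type u} [CompleteBooleanAlgebra Θ] (x y : Θ) : Prop := ¬ Separated x y

/-- `MadeOf B z`: the thing `z` is made out of members of `B` by means of juxtapositions and
superimpositions. -/
inductive MadeOf {Θ : Type u} [CompleteBooleanAlgebra Θ] (B : Set Θ) : Θ → Prop
  | of (z : Θ) : z ∈ B → MadeOf B z
  | juxtapose (T : Set Θ) : (∀ z ∈ T, MadeOf B z) → MadeOf B (sSup T)
  | superimpose (T : Set Θ) : (∀ z ∈ T, MadeOf B z) → MadeOf B (sInf T)

/-- The primitive notions of the theory: basic things, their states, temporal order, proper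
histories and local times, and the (universal) action of basic things on one another. -/
structure Ontology (Θ : Type u) [CompleteBooleanAlgebra Θ] where
  /-- The basic things. -/
  basic : Set Θ
  bot_notMem_basic : ⊥ ∉ basic
  eq_of_le : ∀ x ∈ basic, ∀ y ∈ basic, x ≤ y → x = y
  madeOf_basic : ∀ z : Θ, MadeOf basic z
  /-- The lawful states of a basic thing. -/
  State : basic → Type v
  /-- The temporal order of the states of a basic thing. -/
  order : ∀ x, PartialOrder (State x)
  /-- The proper history of a basic thing. (It is totally ordered and Dedekind complete, by the
  existence of a local time.) -/
  history : ∀ x, Set (State x)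
  /-- The local time of a basic thing, in some unit. -/
  localTime : ∀ x, history x ≃o ℝ
  /-- `action x y s` is the state of `y` from which on the history of `y` is modified by the action
  of `x` on `y` that starts at the state `s` of `x`. Any two basic things interact, all along their
  histories: every action arrives, actions that start later arrive later, and every state of `y`
  is the arrival of an action of `x`. -/
  action : ∀ x y, history x ≃o history y
  /-- The constant that converts times into distances. -/
  c : ℝ
  c_pos : 0 < c

attribute [instance] Ontology.order

namespace Ontology

variable {Θ : Type u} [CompleteBooleanAlgebra Θ] (W : Ontology.{u, v} Θ)

/-- In the reflex action of `x` on `y` that is reflected at the state `t` of `y`, the local time of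
`x` at which the action of `x` on `y` starts. -/
noncomputable def reflexStart (x : W.basic) {y : W.basic} (t : W.history y) : ℝ :=
  W.localTime x ((W.action x y).symm t)

/-- In the reflex action of `x` on `y` that is reflected at the state `t` of `y`, the local time of
`x` from which on `x` is modified by the action of `y` on `x`. -/
noncomputable def reflexEnd (x : W.basic) {y : W.basic} (t : W.history y) : ℝ :=
  W.localTime x (W.action y x t)

/-- A state in the history of some basic thing, together with that thing. -/
abbrev HState : Type (max u v) := Σ x : W.basic, W.history x

/-- The state `s` of `x` and the state `t` of `y` are simultaneous if the local time of `s` is the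
mean of the start and the end of the reflex action of `x` that is reflected at `t`. -/
def Simultaneous (s t : W.HState) : Prop :=
  W.localTime s.1 s.2 = (1 / 2) * (W.reflexEnd s.1 t.2 + W.reflexStart s.1 t.2)

/-- The ontic distance between (simultaneous) states. -/
noncomputable def onticDist (s t : W.HState) : ℝ :=
  W.c / 2 * |W.reflexEnd s.1 t.2 - W.reflexStart s.1 t.2|

end Ontology

/-- An ontology that satisfies the axioms on reflex actions. -/
structure RelationalWorld (Θ : Type u) [CompleteBooleanAlgebra Θ] extends Ontology.{u, v} Θ where
  /-- Finite speed: for separated basic things the duration of the reflex actions has a positive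
  lower bound. -/
  finite_speed : ∀ x y : basic, Separated (x : Θ) y →
    ∃ ε > 0, ∀ t : history y, ε ≤ toOntology.reflexEnd x t - toOntology.reflexStart x t
  /-- Between united basic things (in particular, from a basic thing to itself) the reflex actions
  take no time; that is, united basic things have ontic distance zero. -/
  reflex_united : ∀ x y : basic, United (x : Θ) y →
    ∀ t : history y, toOntology.reflexEnd x t = toOntology.reflexStart x t
  /-- Synchronizability: the local times are such that simultaneity is transitive. -/
  simultaneous_trans : ∀ r s t : toOntology.HState,
    toOntology.Simultaneous r s → toOntology.Simultaneous s t → toOntology.Simultaneous r t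
  /-- The ontic distance is a pseudometric on every class of simultaneous states: symmetry. -/
  onticDist_comm : ∀ s t : toOntology.HState, toOntology.Simultaneous s t →
    toOntology.onticDist s t = toOntology.onticDist t s
  /-- The ontic distance is a pseudometric on every class of simultaneous states: triangle
  inequality. -/
  onticDist_triangle : ∀ r s t : toOntology.HState,
    toOntology.Simultaneous r s → toOntology.Simultaneous s t →
    toOntology.onticDist r t ≤ toOntology.onticDist r s + toOntology.onticDist s t

namespace RelationalWorld

variable {Θ : Type u} [CompleteBooleanAlgebra Θ] (W : RelationalWorld.{u, v} Θ)

theorem united_self (x : W.basic) : United (x : Θ) x := by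
  intro h
  have h' : (x : Θ) ⊓ x = ⊥ := h
  rw [inf_idem] at h'
  exact W.bot_notMem_basic (h' ▸ x.2)

theorem action_self (x : W.basic) (t : W.history x) : W.action x x t = t := by
  have h : W.action x x t = (W.action x x).symm t :=
    (W.localTime x).injective (W.reflex_united x x (W.united_self x) t)
  have h2 : W.action x x (W.action x x t) = t := by rw [h]; simp
  by_contra hne
  rcases lt_or_gt_of_ne (fun hh => hne ((W.localTime x).injective hh) :
      W.localTime x (W.action x x t) ≠ W.localTime x t) with hlt | hlt
  · have hlt' := (W.localTime x).lt_iff_lt.1 hlt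
    have := (W.action x x).lt_iff_lt.2 hlt'
    rw [h2] at this
    exact lt_asymm this hlt'
  · have hlt' := (W.localTime x).lt_iff_lt.1 hlt
    have := (W.action x x).lt_iff_lt.2 hlt'
    rw [h2] at this
    exact lt_asymm this hlt'

/-- Simultaneous states of one and the same thing are equal. -/
theorem simultaneous_same_iff (x : W.basic) (s t : W.history x) :
    W.Simultaneous ⟨x, s⟩ ⟨x, t⟩ ↔ s = t := by
  have h1 := W.reflex_united x x (W.united_self x) t
  have h2 : W.reflexEnd x t = W.localTime x t := by
    simp only [Ontology.reflexEnd, action_self]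
  simp only [Ontology.Simultaneous, ← h1, h2]
  constructor
  · intro h
    apply (W.localTime x).injective
    linarith
  · rintro rfl
    ring

theorem simultaneous_refl (s : W.HState) : W.Simultaneous s s :=
  (W.simultaneous_same_iff s.1 s.2 s.2).2 rfl

/-- The state of `x` that is simultaneous with the state `e`. -/
noncomputable def stateAt (e : W.HState) (x : W.basic) : W.history x :=
  (W.localTime x).symm ((1 / 2) * (W.reflexEnd x e.2 + W.reflexStart x e.2))

theorem simultaneous_stateAt (e : W.HState) (x : W.basic) :
    W.Simultaneous ⟨x, W.stateAt e x⟩ e := by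
  simp [Ontology.Simultaneous, stateAt]

theorem simultaneous_symm {s t : W.HState} (h : W.Simultaneous s t) : W.Simultaneous t s := by
  have h1 := W.simultaneous_stateAt s t.1
  have h2 := W.simultaneous_trans _ _ _ h1 h
  have h3 := (W.simultaneous_same_iff t.1 _ _).1 h2
  rw [h3] at h1
  exact h1

theorem simultaneous_equivalence : Equivalence W.Simultaneous :=
  ⟨W.simultaneous_refl, W.simultaneous_symm, fun h h' => W.simultaneous_trans _ _ _ h h'⟩

theorem onticDist_united {s t : W.HState} (h : United (s.1 : Θ) t.1) : W.onticDist s t = 0 := by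
  simp [Ontology.onticDist, W.reflex_united s.1 t.1 h]

theorem onticDist_separated {s t : W.HState} (h : Separated (s.1 : Θ) t.1) :
    0 < W.onticDist s t := by
  obtain ⟨ε, hε, hb⟩ := W.finite_speed s.1 t.1 h
  have := hb t.2
  have h1 : 0 < |W.reflexEnd s.1 t.2 - W.reflexStart s.1 t.2| := abs_pos.2 (by linarith)
  have h2 := W.c_pos
  unfold Ontology.onticDist
  positivity

/-! ## Ontic space and ontic points -/

/-- Ontic space: the class of the states that are simultaneous with a given state `e`. -/
def OnticSpace (e : W.HState) : Type (max u v) := {s : W.HState // W.Simultaneous s e}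

noncomputable instance (e : W.HState) : PseudoMetricSpace (W.OnticSpace e) where
  dist s t := W.onticDist s.1 t.1
  dist_self s := W.onticDist_united (W.united_self _)
  dist_comm s t := W.onticDist_comm _ _
    (W.simultaneous_trans _ _ _ s.2 (W.simultaneous_symm t.2))
  dist_triangle r s t := W.onticDist_triangle _ _ _
    (W.simultaneous_trans _ _ _ r.2 (W.simultaneous_symm s.2))
    (W.simultaneous_trans _ _ _ s.2 (W.simultaneous_symm t.2))

/-- The place of a basic thing in ontic space: its only state there. -/
noncomputable def place (e : W.HState) (x : W.basic) : W.OnticSpace e :=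
  ⟨⟨x, W.stateAt e x⟩, W.simultaneous_stateAt e x⟩

theorem place_unique (e : W.HState) (s : W.OnticSpace e) : s = W.place e s.1.1 := by
  obtain ⟨⟨x, s⟩, hs⟩ := s
  have h := W.simultaneous_trans _ _ _ hs (W.simultaneous_symm (W.simultaneous_stateAt e x))
  have := (W.simultaneous_same_iff x _ _).1 h
  subst this
  rfl

/-- A complete family of united (basic) things. -/
structure IsCompleteFamily (ξ : Set W.basic) : Prop where
  united : ∀ x ∈ ξ, ∀ y ∈ ξ, United (x : Θ) y
  complete : ∀ x ∉ ξ, ∃ y ∈ ξ, Separated (x : Θ) y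

/-- The ontic points, that is, the complete families of united things, of the ontic space of `e`.
(They do not depend on `e`, but their distance does.) -/
def OnticPoint (_e : W.HState) : Type u := {ξ : Set W.basic // W.IsCompleteFamily ξ}

variable {W}

/-- The distance between two ontic points is the supremum of the ontic distances between the things
of the one and the things of the other. -/
noncomputable def OnticPoint.distG {e : W.HState} (ξ η : W.OnticPoint e) : ℝ :=
  ⨆ p : ξ.1 × η.1, dist (W.place e p.1) (W.place e p.2)

theorem dist_place_united (e : W.HState) {x y : W.basic} (h : United (x : Θ) y) :
    dist (W.place e x) (W.place e y) = 0 :=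
  W.onticDist_united h

theorem dist_place_separated (e : W.HState) {x y : W.basic} (h : Separated (x : Θ) y) :
    0 < dist (W.place e x) (W.place e y) :=
  W.onticDist_separated h

theorem OnticPoint.nonempty {e : W.HState} (ξ : W.OnticPoint e) : ξ.1.Nonempty := by
  by_contra h
  rw [Set.not_nonempty_iff_eq_empty] at h
  obtain ⟨y, hy, _⟩ := ξ.2.complete e.1 (by simp [h])
  simp [h] at hy

/-- All the things of `ξ` have the same ontic distance from all the things of `η`, so that the
supremum is finite. -/
theorem OnticPoint.distG_eq {e : W.HState} (ξ η : W.OnticPoint e) {x y : W.basic}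
    (hx : x ∈ ξ.1) (hy : y ∈ η.1) : ξ.distG η = dist (W.place e x) (W.place e y) := by
  have : Nonempty (ξ.1 × η.1) := ⟨⟨⟨x, hx⟩, ⟨y, hy⟩⟩⟩
  have h : ∀ p : ξ.1 × η.1, dist (W.place e p.1) (W.place e p.2) =
      dist (W.place e x) (W.place e y) := by
    rintro ⟨⟨a, ha⟩, ⟨b, hb⟩⟩
    have h1 := dist_place_united e (ξ.2.united a ha x hx)
    have h2 := dist_place_united e (η.2.united b hb y hy)
    have h3 := dist_triangle4 (W.place e a) (W.place e x) (W.place e y) (W.place e b)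
    have h4 := dist_triangle4 (W.place e x) (W.place e a) (W.place e b) (W.place e y)
    rw [dist_comm (W.place e y) (W.place e b)] at h3
    rw [dist_comm (W.place e x) (W.place e a)] at h4
    apply le_antisymm <;> dsimp only <;> linarith
  unfold OnticPoint.distG
  simp only [h, ciSup_const]

/-- The ontic points form a metric space. -/
noncomputable instance (e : W.HState) : MetricSpace (W.OnticPoint e) where
  dist := OnticPoint.distG
  dist_self ξ := by
    obtain ⟨x, hx⟩ := ξ.nonempty
    rw [ξ.distG_eq ξ hx hx, dist_self]
  dist_comm ξ η := by
    obtain ⟨x, hx⟩ := ξ.nonempty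
    obtain ⟨y, hy⟩ := η.nonempty
    rw [ξ.distG_eq η hx hy, η.distG_eq ξ hy hx, dist_comm]
  dist_triangle ξ η ζ := by
    obtain ⟨x, hx⟩ := ξ.nonempty
    obtain ⟨y, hy⟩ := η.nonempty
    obtain ⟨z, hz⟩ := ζ.nonempty
    rw [ξ.distG_eq η hx hy, η.distG_eq ζ hy hz, ξ.distG_eq ζ hx hz]
    exact dist_triangle _ _ _
  eq_of_dist_eq_zero := by
    intro ξ η h
    have key : ∀ ξ η : W.OnticPoint e, ξ.distG η = 0 → ξ.1 ⊆ η.1 := by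
      intro ξ η h x hx
      by_contra hxη
      obtain ⟨y, hy, hs⟩ := η.2.complete x hxη
      rw [ξ.distG_eq η hx hy] at h
      exact absurd h (dist_place_separated e hs).ne'
    apply Subtype.ext
    apply Set.Subset.antisymm (key ξ η h)
    apply key η ξ
    obtain ⟨x, hx⟩ := ξ.nonempty
    obtain ⟨y, hy⟩ := η.nonempty
    have h' : ξ.distG η = 0 := h
    rw [ξ.distG_eq η hx hy] at h'
    rw [η.distG_eq ξ hy hx, dist_comm, h']

variable (W)

/-- Geometric space: the completion of the metric space of ontic points. -/
abbrev GeometricSpace (e : W.HState) : Type u := UniformSpace.Completion (W.OnticPoint e)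

end RelationalWorld

/-! ## The metric axioms of Euclidean geometry -/

/-- The point `q` lies (strictly) between `p` and `r`. -/
def MetricBetween {X : Type u} [MetricSpace X] (p q r : X) : Prop :=
  p ≠ q ∧ q ≠ r ∧ dist p q + dist q r = dist p r

/-- Three points are aligned if one of their three distances is the sum of the other two. -/
def Aligned {X : Type u} [MetricSpace X] (p q r : X) : Prop :=
  dist p q + dist q r = dist p r ∨ dist q r + dist r p = dist q p ∨
    dist r p + dist p q = dist r q

/-- The Cayley–Menger determinant of finitely many points: the determinant of the matrix of the
squared distances, bordered by a row and a column of ones with a zero in the corner. For four points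
of Euclidean space it is `288` times the square of the volume of the tetrahedron. -/
noncomputable def cayleyMenger {X : Type u} [MetricSpace X] {n : ℕ} (p : Fin n → X) : ℝ :=
  Matrix.det (Matrix.of fun i j : Option (Fin n) =>
    match i, j with
    | none, none => (0 : ℝ)
    | none, some _ => 1
    | some _, none => 1
    | some i, some j => dist (p i) (p j) ^ 2)

/-- Four points are non coplanar if they span a tetrahedron of positive volume. -/
def NonCoplanar {X : Type u} [MetricSpace X] (p : Fin 4 → X) : Prop := 0 < cayleyMenger p

/-- The axioms `2`, `3`, `5'`, `6'` and `7` (all but metricity and completeness) of Blumenthal's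
axioms of three-dimensional Euclidean geometry in terms of the distance. -/
structure BlumenthalAxioms (X : Type u) [MetricSpace X] : Prop where
  /-- Axiom `2`: between any two distinct points there is a third one. -/
  convex : ∀ p r : X, p ≠ r → ∃ q, MetricBetween p q r
  /-- Axiom `3`: beyond any two distinct points there is a third one. -/
  externally_convex : ∀ p q : X, p ≠ q → ∃ r, MetricBetween p q r
  /-- Axiom `5'`: there are three points that are not aligned. -/
  exists_not_aligned : ∃ p q r : X, ¬ Aligned p q r
  /-- Axiom `6'`: there are four non coplanar points. -/
  exists_nonCoplanar : ∃ p : Fin 4 → X, NonCoplanar p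
  /-- Axiom `7`: there is no fourth dimension, that is, no five points span a four-dimensional
  volume. -/
  no_fourth_dimension : ∀ p : Fin 5 → X, cayleyMenger p = 0

/-- A metric space is Euclidean (three-dimensional) if it is isometric to Euclidean 3-space. -/
def IsEuclidean (X : Type u) [MetricSpace X] : Prop :=
  Nonempty (X ≃ᵢ EuclideanSpace ℝ (Fin 3))

/-! Beyond the axioms, only one property of geometric space matters: it is a complete metric space,
being a completion. The rest is Blumenthal's metric characterization of Euclidean space.

The Gram matrix computed from the distances of a non-coplanar quadruple is positive definite, so the
quadruple is realized by a tetrahedron (`exists_points_of_nonCoplanar`). A vanishing five-point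
determinant then gives every further point barycentric coordinates with the right distances to the
four vertices (`exists_point_of_cayleyMenger_eq_zero`). This defines a map `f` to coordinates.

The crux is that `f` preserves the distance of two arbitrary points. Relative to three non-collinear
reference points, the vanishing determinant leaves two values: the right one, or the one obtained by
reflecting one of the two points in the reference plane
(`eq_or_eq_reflection_of_cayleyMenger_eq_zero`). A point between two vertices supplies a third plane
through the opposite edge, and the reflected value cannot occur for all three planes unless it is
the right one (`eq_zero_of_pencil`).

Finally, the image of `f` is closed by completeness, and the two convexity axioms make it contain
the line through any two of its points (`BlumenthalAxioms.line_mem_range`). Being an affine subspace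
that contains a tetrahedron, it is the whole space. -/

open Matrix

/-! ### Cayley–Menger determinants and their kernels -/

section CayleyMenger

variable {X : Type u} [MetricSpace X]

/-- The determinant conditions on five points are used in this form: weights of total mass zero
whose moment of squared distances is the same at all the points. With at least one point, a kernel
vector cannot be supported on the border alone. -/
theorem exists_kernel_of_cayleyMenger_eq_zero {n : ℕ} [NeZero n] {p : Fin n → X}
    (h : cayleyMenger p = 0) :
    ∃ (v : Fin n → ℝ) (k : ℝ), v ≠ 0 ∧ ∑ i, v i = 0 ∧
      ∀ i, ∑ j, dist (p i) (p j) ^ 2 * v j = k := by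
  obtain ⟨v, hv, h0⟩ := Matrix.exists_mulVec_eq_zero_iff.2 h
  have hsum : ∑ i, v (some i) = 0 := by
    have := congrFun h0 none
    simpa [Matrix.mulVec, dotProduct, Fintype.sum_option] using this
  have hrow : ∀ i, v none + ∑ j, dist (p i) (p j) ^ 2 * v (some j) = 0 := by
    intro i
    have := congrFun h0 (some i)
    simpa [Matrix.mulVec, dotProduct, Fintype.sum_option] using this
  refine ⟨fun i => v (some i), -v none, ?_, hsum, fun i => by linarith [hrow i]⟩
  intro hz
  have hz' : ∀ i, v (some i) = 0 := fun i => congrFun hz i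
  apply hv
  funext i
  cases i with
  | none => simpa [hz'] using hrow 0
  | some i => exact hz' i

theorem eq_zero_of_cayleyMenger_ne_zero {n : ℕ} {p : Fin n → X} (h : cayleyMenger p ≠ 0)
    {v : Fin n → ℝ} {k : ℝ} (hsum : ∑ i, v i = 0)
    (hrow : ∀ i, ∑ j, dist (p i) (p j) ^ 2 * v j = k) : v = 0 := by
  by_contra hv
  apply h
  refine Matrix.exists_mulVec_eq_zero_iff.1 ⟨fun i => i.elim (-k) v, ?_, ?_⟩
  · intro hz
    exact hv (funext fun i => congrFun hz (some i))
  · funext i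
    cases i with
    | none => simpa [Matrix.mulVec, dotProduct, Fintype.sum_option] using hsum
    | some i => simp [Matrix.mulVec, dotProduct, Fintype.sum_option, hrow]

/-- By polarization, `a` to `f` play the role of the inner products of the three edge vectors from
`p 0`. The right side is 8 times their Gram determinant. -/
theorem cayleyMenger_four (p : Fin 4 → X) {a b c d e f : ℝ}
    (h01 : dist (p 0) (p 1) ^ 2 = a) (h02 : dist (p 0) (p 2) ^ 2 = d)
    (h03 : dist (p 0) (p 3) ^ 2 = f) (h12 : dist (p 1) (p 2) ^ 2 = a + d - 2 * b)
    (h13 : dist (p 1) (p 3) ^ 2 = a + f - 2 * c) (h23 : dist (p 2) (p 3) ^ 2 = d + f - 2 * e) :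
    cayleyMenger p =
      8 * (a * d * f + 2 * b * c * e - a * e ^ 2 - d * c ^ 2 - f * b ^ 2) := by
  have h : ∀ i j, dist (p i) (p j) = dist (p j) (p i) := fun i j => dist_comm _ _
  have s1 : finSuccEquiv 4 1 = some 0 := rfl
  have s2 : finSuccEquiv 4 2 = some 1 := rfl
  have s3 : finSuccEquiv 4 3 = some 2 := rfl
  have s4 : finSuccEquiv 4 4 = some 3 := rfl
  have hM : cayleyMenger p = Matrix.det !![0, 1, 1, 1, 1;
      1, 0, a, d, f;
      1, a, 0, a + d - 2 * b, a + f - 2 * c;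
      1, d, a + d - 2 * b, 0, d + f - 2 * e;
      1, f, a + f - 2 * c, d + f - 2 * e, 0] := by
    unfold cayleyMenger
    rw [← Matrix.det_submatrix_equiv_self (finSuccEquiv 4)]
    congr 1
    ext i j
    fin_cases i <;> fin_cases j <;> simp [s1, s2, s3, s4, h01, h02, h03, h12, h13, h23,
      h 1 0, h 2 0, h 3 0, h 2 1, h 3 1, h 3 2]
  rw [hM]
  simp [Matrix.det_succ_row_zero, Fin.sum_univ_succ, Fin.succAbove]
  ring

end CayleyMenger

/-! ### Realizing a tetrahedron from its Gram matrix -/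

/-- A `3 × 3` symmetric matrix with positive leading minors is a Gram matrix. -/
theorem exists_vectors_of_gram {a b c d e f : ℝ} (ha : 0 < a) (hA : 0 < a * d - b ^ 2)
    (hD : 0 < a * d * f + 2 * b * c * e - a * e ^ 2 - d * c ^ 2 - f * b ^ 2) :
    ∃ u v w : Fin 3 → ℝ, u ⬝ᵥ u = a ∧ u ⬝ᵥ v = b ∧ u ⬝ᵥ w = c ∧ v ⬝ᵥ v = d ∧ v ⬝ᵥ w = e ∧
      w ⬝ᵥ w = f ∧ u ⬝ᵥ v ⨯₃ w ≠ 0 := by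
  -- Cholesky factorization: the leading minors are `α ^ 2`, `(α * β) ^ 2` and `(α * β * γ) ^ 2`,
  -- and the vectors are the rows of the lower triangular factor.
  obtain ⟨α, hα, rfl⟩ : ∃ α : ℝ, 0 < α ∧ a = α ^ 2 :=
    ⟨√a, Real.sqrt_pos.2 ha, (Real.sq_sqrt ha.le).symm⟩
  obtain ⟨β, hβ, hβ2⟩ : ∃ β : ℝ, 0 < β ∧ α ^ 2 * d - b ^ 2 = (α * β) ^ 2 := by
    refine ⟨√(α ^ 2 * d - b ^ 2) / α, div_pos (Real.sqrt_pos.2 hA) hα, ?_⟩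
    rw [mul_div_cancel₀ _ hα.ne', Real.sq_sqrt hA.le]
  obtain ⟨γ, hγ, hγ2⟩ : ∃ γ : ℝ, 0 < γ ∧ α ^ 2 * d * f + 2 * b * c * e - α ^ 2 * e ^ 2
      - d * c ^ 2 - f * b ^ 2 = (α * β * γ) ^ 2 := by
    refine ⟨√(α ^ 2 * d * f + 2 * b * c * e - α ^ 2 * e ^ 2 - d * c ^ 2 - f * b ^ 2) / (α * β),
      div_pos (Real.sqrt_pos.2 hD) (mul_pos hα hβ), ?_⟩
    rw [mul_div_cancel₀ _ (mul_pos hα hβ).ne', Real.sq_sqrt hD.le]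
  have hd : d = β ^ 2 + b ^ 2 / α ^ 2 := by
    field_simp
    linarith
  refine ⟨![α, 0, 0], ![b / α, β, 0], ![c / α, (e - b * c / α ^ 2) / β, γ], ?_, ?_, ?_, ?_, ?_,
    ?_, ?_⟩
  · simp [dotProduct, Fin.sum_univ_succ]; ring
  · simp [dotProduct, Fin.sum_univ_succ]; field_simp
  · simp [dotProduct, Fin.sum_univ_succ]; field_simp
  · simp [dotProduct, Fin.sum_univ_succ]; rw [hd]; ring
  · simp [dotProduct, Fin.sum_univ_succ]; field_simp; ring
  · simp [dotProduct, Fin.sum_univ_succ]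
    have h1 : (α * β) ^ 2 ≠ 0 := (pow_pos (mul_pos hα hβ) 2).ne'
    apply mul_left_cancel₀ h1
    have h2 : (α * β) ^ 2 * (c / α * (c / α) + ((e - b * c / α ^ 2) / β * ((e - b * c / α ^ 2) / β)
        + γ * γ)) = β ^ 2 * c ^ 2 + (α * e - b * c / α) ^ 2 + (α * β * γ) ^ 2 := by
      field_simp
      ring
    rw [h2, ← hγ2, ← hβ2, hd]
    field_simp
    ring
  · simp [dotProduct, Fin.sum_univ_succ, cross_apply]
    exact ⟨hα.ne', hβ.ne', hγ.ne'⟩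

section Gram

variable {X : Type u} [MetricSpace X]

theorem exists_points_of_nonCoplanar {p : Fin 4 → X} (hp : NonCoplanar p) :
    ∃ P : Fin 4 → Fin 3 → ℝ, (∀ i j, dist (p i) (p j) ^ 2 = (P i - P j) ⬝ᵥ (P i - P j)) ∧
      (P 1 - P 0) ⬝ᵥ (P 2 - P 0) ⨯₃ (P 3 - P 0) ≠ 0 := by
  -- Cauchy–Schwarz for the polarized inner product amounts to the triangle inequalities of the
  -- three points.
  have minor : ∀ x y z : X, ((dist x y ^ 2 + dist x z ^ 2 - dist y z ^ 2) / 2) ^ 2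
      ≤ dist x y ^ 2 * dist x z ^ 2 := by
    intro x y z
    have h1 := dist_triangle x y z
    have h2 := dist_triangle y x z
    have h3 := dist_triangle x z y
    rw [dist_comm y x] at h2
    rw [dist_comm z y] at h3
    have h4 := abs_le_of_sq_le_sq' (a := (dist x y ^ 2 + dist x z ^ 2 - dist y z ^ 2) / 2)
      (b := dist x y * dist x z)
    rw [← mul_pow]
    apply sq_le_sq'
    · nlinarith [@dist_nonneg _ _ y z]
    · nlinarith [mul_nonneg (sub_nonneg.2 h1) (sub_nonneg.2 h3)]
  have m12 := minor (p 0) (p 1) (p 2)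
  have m13 := minor (p 0) (p 1) (p 3)
  have ha0 := sq_nonneg (dist (p 0) (p 1))
  have hsym : ∀ i j, dist (p i) (p j) = dist (p j) (p i) := fun i j => dist_comm _ _
  set a := dist (p 0) (p 1) ^ 2 with ha
  set d := dist (p 0) (p 2) ^ 2 with hd
  set f := dist (p 0) (p 3) ^ 2 with hf
  obtain ⟨b, hb⟩ : ∃ b, b = (a + d - dist (p 1) (p 2) ^ 2) / 2 := ⟨_, rfl⟩
  obtain ⟨c, hc⟩ : ∃ c, c = (a + f - dist (p 1) (p 3) ^ 2) / 2 := ⟨_, rfl⟩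
  obtain ⟨e, he⟩ : ∃ e, e = (d + f - dist (p 2) (p 3) ^ 2) / 2 := ⟨_, rfl⟩
  rw [← hb] at m12
  rw [← hc] at m13
  have hD' : 0 < a * d * f + 2 * b * c * e - a * e ^ 2 - d * c ^ 2 - f * b ^ 2 := by
    have h := cayleyMenger_four p (a := a) (b := b) (c := c) (d := d) (e := e) (f := f) rfl rfl rfl
      (by rw [hb]; ring) (by rw [hc]; ring) (by rw [he]; ring)
    have : 0 < cayleyMenger p := hp
    linarith
  have ha' : 0 < a := by
    refine lt_of_le_of_ne ha0 fun h0 => ?_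
    rw [← h0] at m12 m13 hD'
    have b0 : b = 0 := by nlinarith
    have c0 : c = 0 := by nlinarith
    rw [b0, c0] at hD'
    simp at hD'
  have hA : 0 < a * d - b ^ 2 := by
    refine lt_of_le_of_ne (by linarith) fun h0 => ?_
    -- Sylvester's identity: with a vanishing second minor, `a` times the determinant would be minus
    -- a square.
    have : a * (a * d * f + 2 * b * c * e - a * e ^ 2 - d * c ^ 2 - f * b ^ 2) =
      (a * d - b ^ 2) * (a * f - c ^ 2) - (a * e - b * c) ^ 2 := by ring
    rw [← h0] at this
    nlinarith [mul_pos ha' hD', sq_nonneg (a * e - b * c)]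
  obtain ⟨u, v, w, h1, h2, h3, h4, h5, h6, h7⟩ := exists_vectors_of_gram ha' hA hD'
  refine ⟨![0, u, v, w], ?_, by simpa using h7⟩
  have h2' := (dotProduct_comm v u).trans h2
  have h3' := (dotProduct_comm w u).trans h3
  have h5' := (dotProduct_comm w v).trans h5
  intro i j
  fin_cases i <;> fin_cases j <;>
    simp [sub_dotProduct, dotProduct_sub, h1, h2, h3, h4, h5, h6, h2', h3', h5',
      hsym 1 0, hsym 2 0, hsym 3 0, hsym 2 1, hsym 3 1, hsym 3 2] <;> linarith

end Gram

/-! ### Placing a fifth point, and the reflection ambiguity -/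

section Embedding

variable {X : Type u} [MetricSpace X]

theorem exists_point_of_cayleyMenger_eq_zero {p : Fin 4 → X} {P : Fin 4 → Fin 3 → ℝ}
    (hP : ∀ i j, dist (p i) (p j) ^ 2 = (P i - P j) ⬝ᵥ (P i - P j)) (hp : cayleyMenger p ≠ 0)
    {q : X} (hq : cayleyMenger (Fin.snoc p q : Fin 5 → X) = 0) :
    ∃ Q : Fin 3 → ℝ, ∀ i, dist q (p i) ^ 2 = (Q - P i) ⬝ᵥ (Q - P i) := by
  obtain ⟨v, k, hv, hsum, hrow⟩ := exists_kernel_of_cayleyMenger_eq_zero hq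
  have hrow' : ∀ i, ∑ j, dist (p i) (p j) ^ 2 * v j.castSucc +
      dist (p i) q ^ 2 * v (Fin.last 4) = k := by
    intro i
    have := hrow i.castSucc
    rw [Fin.sum_univ_castSucc] at this
    simpa only [Fin.snoc_castSucc, Fin.snoc_last] using this
  have hlast : ∑ j, dist q (p j) ^ 2 * v j.castSucc = k := by
    have := hrow (Fin.last 4)
    rw [Fin.sum_univ_castSucc] at this
    simpa only [Fin.snoc_castSucc, Fin.snoc_last, dist_self, zero_pow two_ne_zero, zero_mul,
      add_zero] using this
  rw [Fin.sum_univ_castSucc] at hsum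
  -- Otherwise the weights would form a kernel vector for the nondegenerate quadruple. Dividing by
  -- minus this entry gives barycentric coordinates `α` of the new point.
  have ht : v (Fin.last 4) ≠ 0 := by
    intro ht
    rw [ht, add_zero] at hsum
    have h0 := eq_zero_of_cayleyMenger_ne_zero hp hsum (k := k) fun i => by
      simpa only [ht, mul_zero, add_zero] using hrow' i
    apply hv
    funext i
    refine Fin.lastCases ht (fun i => congrFun h0 i) i
  set t := v (Fin.last 4)
  obtain ⟨α, hα⟩ : ∃ α : Fin 4 → ℝ, ∀ i, v i.castSucc = -t * α i :=
    ⟨fun i => -(v i.castSucc / t), fun i => by field_simp⟩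
  obtain ⟨l, hl⟩ : ∃ l, k = -t * l := ⟨-(k / t), by field_simp⟩
  simp only [hα, hl, mul_left_comm _ (-t), ← Finset.mul_sum] at hsum hrow' hlast
  have nt : -t ≠ 0 := neg_ne_zero.2 ht
  have hα1 : ∑ i, α i = 1 := by
    apply mul_left_cancel₀ nt
    linarith
  have hr : ∀ i, ∑ j, dist (p i) (p j) ^ 2 * α j = dist q (p i) ^ 2 + l := by
    intro i
    apply mul_left_cancel₀ nt
    rw [dist_comm q]
    linarith [hrow' i]
  have hq' := mul_left_cancel₀ nt hlast
  obtain ⟨Q, hQ⟩ : ∃ Q : Fin 3 → ℝ, Q = ∑ j, α j • P j := ⟨_, rfl⟩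
  -- The moment about `Z` is the moment about the barycenter plus the squared distance of `Z` from
  -- it.
  have huygens : ∀ Z : Fin 3 → ℝ, ∑ j, (P j - Z) ⬝ᵥ (P j - Z) * α j =
      ∑ j, (Q - P j) ⬝ᵥ (Q - P j) * α j + (Q - Z) ⬝ᵥ (Q - Z) := by
    intro Z
    simp only [Fin.sum_univ_four] at hα1
    simp only [hQ, Fin.sum_univ_four, dotProduct, Fin.sum_univ_three, Pi.sub_apply, Pi.add_apply,
      Pi.smul_apply, smul_eq_mul]
    have h3 : α 3 = 1 - α 0 - α 1 - α 2 := by linarith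
    rw [h3]
    ring
  obtain ⟨K, hK⟩ : ∃ K, K = ∑ j, (Q - P j) ⬝ᵥ (Q - P j) * α j := ⟨_, rfl⟩
  rw [← hK] at huygens
  have key : ∀ i, (Q - P i) ⬝ᵥ (Q - P i) = dist q (p i) ^ 2 + l - K := by
    intro i
    rw [← hr i, ← sub_eq_of_eq_add' (huygens (P i))]
    congr 1
    refine Finset.sum_congr rfl fun j _ => ?_
    rw [← hP, dist_comm]
  -- Averaging `key` with the weights `α` gives `K = 2 * l - K`, so the additive error vanishes.
  have hKl : K = l := by
    have : K = l + l - K := by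
      nth_rewrite 1 [hK]
      simp only [key, add_sub_assoc, add_mul, Finset.sum_add_distrib, hq', ← Finset.mul_sum, hα1,
        mul_one]
    linarith
  refine ⟨Q, fun i => ?_⟩
  rw [key, hKl]
  ring

/-- The second alternative says that `dist q r` is the distance from `f q` to the mirror image of `f
r` in the plane of `f a`, `f b`, `f c`, whose normal is `n`. -/
theorem eq_or_eq_reflection_of_cayleyMenger_eq_zero {a b c q r : X}
    (h : cayleyMenger ![a, b, c, q, r] = 0) {f : X → Fin 3 → ℝ}
    (hab : dist a b ^ 2 = (f a - f b) ⬝ᵥ (f a - f b))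
    (hac : dist a c ^ 2 = (f a - f c) ⬝ᵥ (f a - f c))
    (hbc : dist b c ^ 2 = (f b - f c) ⬝ᵥ (f b - f c))
    (hqa : dist q a ^ 2 = (f q - f a) ⬝ᵥ (f q - f a))
    (hqb : dist q b ^ 2 = (f q - f b) ⬝ᵥ (f q - f b))
    (hqc : dist q c ^ 2 = (f q - f c) ⬝ᵥ (f q - f c))
    (hra : dist r a ^ 2 = (f r - f a) ⬝ᵥ (f r - f a))
    (hrb : dist r b ^ 2 = (f r - f b) ⬝ᵥ (f r - f b))
    (hrc : dist r c ^ 2 = (f r - f c) ⬝ᵥ (f r - f c))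
    {δ : ℝ} (hδ : dist q r ^ 2 = (f q - f r) ⬝ᵥ (f q - f r) + δ)
    {n : Fin 3 → ℝ} (hn : n = (f b - f a) ⨯₃ (f c - f a)) (hn0 : n ≠ 0) :
    δ = 0 ∨ δ * (n ⬝ᵥ n) = 4 * (n ⬝ᵥ (f q - f a)) * (n ⬝ᵥ (f r - f a)) := by
  obtain ⟨v, k, hv, hsum, hrow⟩ := exists_kernel_of_cayleyMenger_eq_zero h
  have r0 := hrow 0
  have r1 := hrow 1
  have r2 := hrow 2
  have r3 := hrow 3
  have r4 := hrow 4
  simp [Fin.sum_univ_five] at r0 r1 r2 r3 r4 hsum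
  rw [dist_comm a q, dist_comm a r] at r0
  rw [dist_comm b a, dist_comm b q, dist_comm b r] at r1
  rw [dist_comm c a, dist_comm c b, dist_comm c q, dist_comm c r] at r2
  rw [dist_comm r q] at r4
  rw [hab, hac, hqa, hra] at r0
  rw [hab, hbc, hqb, hrb] at r1
  rw [hac, hbc, hqc, hrc] at r2
  rw [hqa, hqb, hqc, hδ] at r3
  rw [hra, hrb, hrc, hδ] at r4
  obtain ⟨B, hB⟩ : ∃ B, B = f b - f a := ⟨_, rfl⟩
  obtain ⟨C, hC⟩ : ∃ C, C = f c - f a := ⟨_, rfl⟩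
  obtain ⟨x, hx⟩ : ∃ x, x = f q - f a := ⟨_, rfl⟩
  obtain ⟨y, hy⟩ : ∃ y, y = f r - f a := ⟨_, rfl⟩
  have eb : f b = f a + B := by rw [hB]; abel
  have ec : f c = f a + C := by rw [hC]; abel
  have eq : f q = f a + x := by rw [hx]; abel
  have er : f r = f a + y := by rw [hy]; abel
  rw [← hB, ← hC] at hn
  rw [← hx, ← hy]
  have hv0 : v 0 = -v 1 - v 2 - v 3 - v 4 := by linarith
  -- The weights have sum zero, so `U` is their moment about any origin. Subtracting the other
  -- kernel equations from that of `a` evaluates inner products with `U`: it is orthogonal to `B`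
  -- and `C`, hence parallel to `n`.
  obtain ⟨U, hU⟩ : ∃ U, U = v 1 • B + v 2 • C + v 3 • x + v 4 • y := ⟨_, rfl⟩
  have hBU : B ⬝ᵥ U = 0 := by
    simp only [hU, eb, ec, eq, er, hv0, dotProduct, Fin.sum_univ_three, Pi.sub_apply, Pi.add_apply,
      Pi.smul_apply, smul_eq_mul] at r0 r1 ⊢
    linear_combination (r0 - r1) / 2
  have hCU : C ⬝ᵥ U = 0 := by
    simp only [hU, eb, ec, eq, er, hv0, dotProduct, Fin.sum_univ_three, Pi.sub_apply, Pi.add_apply,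
      Pi.smul_apply, smul_eq_mul] at r0 r2 ⊢
    linear_combination (r0 - r2) / 2
  have hxU : 2 * (x ⬝ᵥ U) = δ * v 4 := by
    simp only [hU, eb, ec, eq, er, hv0, dotProduct, Fin.sum_univ_three, Pi.sub_apply, Pi.add_apply,
      Pi.smul_apply, smul_eq_mul] at r0 r3 ⊢
    linear_combination (r0 - r3)
  have hyU : 2 * (y ⬝ᵥ U) = δ * v 3 := by
    simp only [hU, eb, ec, eq, er, hv0, dotProduct, Fin.sum_univ_three, Pi.sub_apply, Pi.add_apply,
      Pi.smul_apply, smul_eq_mul] at r0 r4 ⊢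
    linear_combination (r0 - r4)
  have hnU : n ⬝ᵥ U = v 3 * (n ⬝ᵥ x) + v 4 * (n ⬝ᵥ y) := by
    rw [hU, hn]
    simp [dotProduct, Fin.sum_univ_three, cross_apply]
    ring
  have hN : ∀ z, (n ⬝ᵥ n) * (z ⬝ᵥ U) = (n ⬝ᵥ U) * (n ⬝ᵥ z) := by
    intro z
    have h1 : n ⨯₃ U = 0 := by
      rw [hn, cross_cross_eq_smul_sub_smul, hBU, hCU]
      simp
    have h2 : (n ⨯₃ U) ⬝ᵥ (n ⨯₃ z) = 0 := by rw [h1, zero_dotProduct]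
    rw [cross_dot_cross] at h2
    rw [dotProduct_comm z U]
    rw [dotProduct_comm U n] at h2
    linarith
  have hNpos : n ⬝ᵥ n ≠ 0 := fun h => hn0 (dotProduct_self_eq_zero.1 h)
  by_cases hδ0 : δ = 0
  · exact Or.inl hδ0
  right
  have hxN := hN x
  have hyN := hN y
  -- Otherwise `U`, `v 3` and `v 4` vanish, and the independence of `B` and `C` kills the remaining
  -- weights.
  have hl : n ⬝ᵥ U ≠ 0 := by
    intro hl
    rw [hl, zero_mul] at hxN hyN
    have hx0 := (mul_eq_zero.1 hxN).resolve_left hNpos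
    have hy0 := (mul_eq_zero.1 hyN).resolve_left hNpos
    have h4 : v 4 = 0 := by
      rw [hx0, mul_zero] at hxU
      exact (mul_eq_zero.1 hxU.symm).resolve_left hδ0
    have h3 : v 3 = 0 := by
      rw [hy0, mul_zero] at hyU
      exact (mul_eq_zero.1 hyU.symm).resolve_left hδ0
    have hU0 : U = 0 := by
      have := hN U
      rw [hl, zero_mul] at this
      exact dotProduct_self_eq_zero.1 ((mul_eq_zero.1 this).resolve_left hNpos)
    rw [hU0, h3, h4, zero_smul, zero_smul, add_zero, add_zero] at hU
    have h1 : v 1 • n = 0 := by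
      rw [hn, ← LinearMap.smul_apply, ← map_smul, eq_sub_of_add_eq hU.symm]
      simp
    have h2 : v 2 • n = 0 := by
      rw [hn, ← map_smul, eq_sub_of_add_eq' hU.symm]
      simp
    have h1' := (smul_eq_zero.1 h1).resolve_right hn0
    have h2' := (smul_eq_zero.1 h2).resolve_right hn0
    apply hv
    funext i
    fin_cases i <;> simp [h1', h2', h3, h4, hv0]
  apply mul_left_cancel₀ hl
  linear_combination δ * (n ⬝ᵥ n) * hnU - (n ⬝ᵥ n) * (n ⬝ᵥ x) * hyU - (n ⬝ᵥ n) * (n ⬝ᵥ y) * hxU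
    + 2 * (n ⬝ᵥ x) * hyN + 2 * (n ⬝ᵥ y) * hxN

/-- If the heights `n ⬝ᵥ x` and `n ⬝ᵥ y` above three planes of a pencil have equal normalized
products, then these products vanish. -/
theorem eq_zero_of_pencil {n m x y : Fin 3 → ℝ} {δ s : ℝ} (hs0 : s ≠ 0) (hs1 : s ≠ 1)
    (hind : ∀ α β : ℝ, α • n + β • m = 0 → α = 0 ∧ β = 0)
    (hn : δ * (n ⬝ᵥ n) = 4 * (n ⬝ᵥ x) * (n ⬝ᵥ y)) (hm : δ * (m ⬝ᵥ m) = 4 * (m ⬝ᵥ x) * (m ⬝ᵥ y))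
    (hnm : δ * ((s • n + (1 - s) • m) ⬝ᵥ (s • n + (1 - s) • m)) =
      4 * ((s • n + (1 - s) • m) ⬝ᵥ x) * ((s • n + (1 - s) • m) ⬝ᵥ y)) : δ = 0 := by
  -- Two quadratic forms on the span of `n` and `m` agree at three pairwise independent vectors, so
  -- their polarizations agree too.
  have hcross : δ * (n ⬝ᵥ m) = 2 * ((n ⬝ᵥ x) * (m ⬝ᵥ y) + (m ⬝ᵥ x) * (n ⬝ᵥ y)) := by
    have h : s * (1 - s) ≠ 0 := mul_ne_zero hs0 (sub_ne_zero.2 hs1.symm)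
    apply mul_left_cancel₀ h
    simp only [add_dotProduct, dotProduct_add, smul_dotProduct, dotProduct_smul, smul_eq_mul,
      dotProduct_comm m n] at hnm
    linear_combination (hnm - s ^ 2 * hn - (1 - s) ^ 2 * hm) / 2
  by_contra hδ
  -- This member of the pencil is orthogonal to `x`, so the product form vanishes on it, whereas `δ`
  -- times the squared norm vanishes only at zero.
  have hz : ((m ⬝ᵥ x) • n + (-(n ⬝ᵥ x)) • m) = 0 := by
    apply dotProduct_self_eq_zero.1
    apply mul_left_cancel₀ hδ
    simp only [add_dotProduct, dotProduct_add, smul_dotProduct, dotProduct_smul, smul_eq_mul,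
      dotProduct_comm m n]
    linear_combination (m ⬝ᵥ x) ^ 2 * hn + (n ⬝ᵥ x) ^ 2 * hm
      - 2 * (m ⬝ᵥ x) * (n ⬝ᵥ x) * hcross
  obtain ⟨-, h0⟩ := hind _ _ hz
  rw [neg_eq_zero.1 h0, mul_zero, zero_mul] at hn
  have hn0 := dotProduct_self_eq_zero.1 ((mul_eq_zero.1 hn).resolve_left hδ)
  exact one_ne_zero (hind 1 0 (by simp [hn0])).1

end Embedding

/-! ### Coordinates that preserve all distances -/

section Isometry

variable {X : Type u} [MetricSpace X]

/-- Equality in the triangle inequality is equality in Cauchy–Schwarz, which makes the two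
difference vectors parallel. -/
theorem exists_eq_of_metricBetween {x y z : X} (h : MetricBetween x y z) {A B C : Fin 3 → ℝ}
    (hxy : dist x y ^ 2 = (A - B) ⬝ᵥ (A - B)) (hyz : dist y z ^ 2 = (B - C) ⬝ᵥ (B - C))
    (hxz : dist x z ^ 2 = (A - C) ⬝ᵥ (A - C)) :
    ∃ s : ℝ, 0 < s ∧ s < 1 ∧ B = s • A + (1 - s) • C := by
  obtain ⟨h1, h2, h3⟩ := h
  have hα : 0 < dist x y := dist_pos.2 h1
  have hβ : 0 < dist y z := dist_pos.2 h2
  rw [← h3] at hxz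
  set α := dist x y
  set β := dist y z
  obtain ⟨V, hV⟩ : ∃ V, V = A - B := ⟨_, rfl⟩
  obtain ⟨W, hW⟩ : ∃ W, W = B - C := ⟨_, rfl⟩
  have hVW : A - C = V + W := by rw [hV, hW]; abel
  rw [← hV] at hxy
  rw [← hW] at hyz
  rw [hVW] at hxz
  have hdot : V ⬝ᵥ W = α * β := by
    simp only [add_dotProduct, dotProduct_add, dotProduct_comm W V] at hxz
    linarith
  have hpar : β • V - α • W = 0 := by
    apply dotProduct_self_eq_zero.1
    simp only [sub_dotProduct, dotProduct_sub, smul_dotProduct, dotProduct_smul, smul_eq_mul,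
      dotProduct_comm W V, hdot, ← hxy, ← hyz]
    ring
  have hs : 0 < α + β := add_pos hα hβ
  refine ⟨β / (α + β), div_pos hβ hs, (div_lt_one hs).2 (by linarith), ?_⟩
  funext i
  have := congrFun hpar i
  simp only [hV, hW, Pi.sub_apply, Pi.smul_apply, Pi.zero_apply, Pi.add_apply, smul_eq_mul]
    at this ⊢
  field_simp
  linarith

theorem BlumenthalAxioms.exists_coordinates (hX : BlumenthalAxioms X) :
    ∃ (f : X → Fin 3 → ℝ) (p : Fin 4 → X),
      (∀ q r, dist q r ^ 2 = (f q - f r) ⬝ᵥ (f q - f r)) ∧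
      (f (p 1) - f (p 0)) ⬝ᵥ (f (p 2) - f (p 0)) ⨯₃ (f (p 3) - f (p 0)) ≠ 0 := by
  obtain ⟨p, hp⟩ := hX.exists_nonCoplanar
  obtain ⟨P, hP, hT⟩ := exists_points_of_nonCoplanar hp
  choose f hf using fun q => exists_point_of_cayleyMenger_eq_zero hP (ne_of_gt hp) (q := q)
    (hX.no_fourth_dimension _)
  have hfp : ∀ i, f (p i) = P i := by
    intro i
    have := hf (p i) i
    rw [dist_self, zero_pow two_ne_zero] at this
    exact sub_eq_zero.1 (dotProduct_self_eq_zero.1 this.symm)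
  simp only [← hfp] at hf hT
  clear hfp hP P
  refine ⟨f, p, fun q r => ?_, hT⟩
  have hf' : ∀ i q, dist (p i) q ^ 2 = (f (p i) - f q) ⬝ᵥ (f (p i) - f q) := by
    intro i q
    rw [dist_comm, hf q i, ← neg_sub (f (p i)), neg_dotProduct_neg]
  have hne : p 2 ≠ p 3 := by
    intro h
    rw [h] at hT
    simp at hT
  -- Together with the edge from `p 0` to `p 1`, the point `m` will span a third plane of the
  -- pencil.
  obtain ⟨m, hm⟩ := hX.convex (p 2) (p 3) hne
  obtain ⟨s, hs0, hs1, hs⟩ := exists_eq_of_metricBetween hm (hf' 2 m) (hf m 3) (hf' 2 _)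
  obtain ⟨u, hu⟩ : ∃ u, u = f (p 1) - f (p 0) := ⟨_, rfl⟩
  obtain ⟨v, hv⟩ : ∃ v, v = f (p 2) - f (p 0) := ⟨_, rfl⟩
  obtain ⟨w, hw⟩ : ∃ w, w = f (p 3) - f (p 0) := ⟨_, rfl⟩
  rw [← hu, ← hv, ← hw] at hT
  have hmv : f m - f (p 0) = s • v + (1 - s) • w := by
    rw [hs, hv, hw]
    module
  have hindep : ∀ α β : ℝ, α • (u ⨯₃ v) + β • (u ⨯₃ w) = 0 → α = 0 ∧ β = 0 := by
    intro α β h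
    have hTw : (u ⨯₃ v) ⬝ᵥ w = u ⬝ᵥ v ⨯₃ w := by
      simp [dotProduct, Fin.sum_univ_three, cross_apply]
      ring
    have hTv : (u ⨯₃ w) ⬝ᵥ v = -(u ⬝ᵥ v ⨯₃ w) := by
      simp [dotProduct, Fin.sum_univ_three, cross_apply]
      ring
    have hw := congrArg (· ⬝ᵥ w) h
    have hv := congrArg (· ⬝ᵥ v) h
    simp only [add_dotProduct, smul_dotProduct, smul_eq_mul, hTw, hTv, zero_dotProduct,
      dotProduct_comm (u ⨯₃ w) w, dotProduct_comm (u ⨯₃ v) v, dot_cross_self, mul_zero, add_zero,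
      zero_add] at hw hv
    exact ⟨(mul_eq_zero.1 hw).resolve_right hT, (mul_eq_zero.1 hv).resolve_right (neg_ne_zero.2 hT)⟩
  have hn1 : u ⨯₃ v ≠ 0 := fun h => one_ne_zero (hindep 1 0 (by simp [h])).1
  have hn2 : u ⨯₃ w ≠ 0 := fun h => one_ne_zero (hindep 0 1 (by simp [h])).2
  -- `f m` lies in the plane of `f (p 0)`, `f (p 2)`, `f (p 3)`, so reflection in that plane fixes
  -- it and both alternatives give the right distance.
  have hm_eq : ∀ x, dist m x ^ 2 = (f m - f x) ⬝ᵥ (f m - f x) := by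
    intro x
    have hn : (f (p 2) - f (p 0)) ⨯₃ (f (p 3) - f (p 0)) ≠ 0 := by
      intro h
      rw [hv, hw, h, dotProduct_zero] at hT
      exact hT rfl
    have hδ : dist m x ^ 2 = (f m - f x) ⬝ᵥ (f m - f x) +
      (dist m x ^ 2 - (f m - f x) ⬝ᵥ (f m - f x)) := by ring
    have h0 : (f (p 2) - f (p 0)) ⨯₃ (f (p 3) - f (p 0)) ⬝ᵥ (f m - f (p 0)) = 0 := by
      rw [← hv, ← hw, hmv, dotProduct_add, dotProduct_smul, dotProduct_smul,
        dotProduct_comm _ v, dotProduct_comm _ w, dot_self_cross, dot_cross_self]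
      simp
    rcases eq_or_eq_reflection_of_cayleyMenger_eq_zero (hX.no_fourth_dimension _)
      (hf' 0 _) (hf' 0 _) (hf' 2 _) (hf m 0) (hf m 2) (hf m 3) (hf x 0) (hf x 2) (hf x 3)
      hδ rfl hn with h | h
    · linarith
    · rw [h0, mul_zero, zero_mul] at h
      have := (mul_eq_zero.1 h).resolve_right fun h => hn (dotProduct_self_eq_zero.1 h)
      linarith
  have hm_eq' : ∀ x, dist x m ^ 2 = (f x - f m) ⬝ᵥ (f x - f m) := by
    intro x
    rw [dist_comm, hm_eq x, ← neg_sub (f x), neg_dotProduct_neg]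
  have hδ : dist q r ^ 2 = (f q - f r) ⬝ᵥ (f q - f r) +
      (dist q r ^ 2 - (f q - f r) ⬝ᵥ (f q - f r)) := by ring
  obtain ⟨δ, hδ'⟩ : ∃ δ, δ = dist q r ^ 2 - (f q - f r) ⬝ᵥ (f q - f r) := ⟨_, rfl⟩
  rw [← hδ'] at hδ
  suffices δ = 0 by rw [hδ, this, add_zero]
  have hn3 : u ⨯₃ (f m - f (p 0)) = s • (u ⨯₃ v) + (1 - s) • (u ⨯₃ w) := by
    rw [hmv, map_add, map_smul, map_smul]
  have hn3' : u ⨯₃ (f m - f (p 0)) ≠ 0 := by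
    rw [hn3]
    intro h
    exact hs0.ne' (hindep _ _ h).1
  rcases eq_or_eq_reflection_of_cayleyMenger_eq_zero (hX.no_fourth_dimension _)
    (hf' 0 _) (hf' 0 _) (hf' 1 _) (hf q 0) (hf q 1) (hf q 2) (hf r 0) (hf r 1) (hf r 2)
    hδ (by rw [hu, hv]) hn1 with h1 | h1
  · exact h1
  rcases eq_or_eq_reflection_of_cayleyMenger_eq_zero (hX.no_fourth_dimension _)
    (hf' 0 _) (hf' 0 _) (hf' 1 _) (hf q 0) (hf q 1) (hf q 3) (hf r 0) (hf r 1) (hf r 3)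
    hδ (by rw [hu, hw]) hn2 with h2 | h2
  · exact h2
  rcases eq_or_eq_reflection_of_cayleyMenger_eq_zero (hX.no_fourth_dimension _)
    (hf' 0 _) (hf' 0 _) (hf' 1 _) (hf q 0) (hf q 1) (hm_eq' q) (hf r 0) (hf r 1) (hm_eq' r)
    hδ (by rw [hu]) hn3' with h3 | h3
  · exact h3
  rw [hn3] at h3
  exact eq_zero_of_pencil hs0.ne' hs1.ne hindep h1 h2 h3

end Isometry

/-! ### The image is the whole space -/

section Surjectivity

/-- A missing point would lie in a gap whose ends belong to the closed set `T`, and `T` has a point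
strictly between these ends. -/
theorem eq_univ_of_forall_exists_between {T : Set ℝ} (hT : IsClosed T)
    (hbtw : ∀ s ∈ T, ∀ t ∈ T, s < t → ∃ r ∈ T, s < r ∧ r < t)
    (hright : ∀ s ∈ T, ∃ r ∈ T, s < r) (hleft : ∀ s ∈ T, ∃ r ∈ T, r < s) (hne : T.Nonempty) :
    T = Set.univ := by
  by_contra h
  obtain ⟨z, hz⟩ := (Set.ne_univ_iff_exists_notMem T).1 h
  have hlo : (T ∩ Set.Iic z).Nonempty := by
    by_contra hlo
    have hb : ∀ t ∈ T, z < t := fun t ht => lt_of_not_ge fun h => hlo ⟨t, ht, h⟩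
    obtain ⟨r, hr, hlt⟩ := hleft _ (hT.csInf_mem hne ⟨z, fun t ht => (hb t ht).le⟩)
    exact absurd (csInf_le ⟨z, fun t ht => (hb t ht).le⟩ hr) (not_le.2 hlt)
  have hhi : (T ∩ Set.Ici z).Nonempty := by
    by_contra hhi
    have hb : ∀ t ∈ T, t < z := fun t ht => lt_of_not_ge fun h => hhi ⟨t, ht, h⟩
    obtain ⟨r, hr, hlt⟩ := hright _ (hT.csSup_mem hne ⟨z, fun t ht => (hb t ht).le⟩)
    exact absurd (le_csSup ⟨z, fun t ht => (hb t ht).le⟩ hr) (not_le.2 hlt)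
  have ba : BddAbove (T ∩ Set.Iic z) := ⟨z, fun t ht => ht.2⟩
  have bb : BddBelow (T ∩ Set.Ici z) := ⟨z, fun t ht => ht.2⟩
  have ha := (hT.inter isClosed_Iic).csSup_mem hlo ba
  have hb := (hT.inter isClosed_Ici).csInf_mem hhi bb
  have haz := lt_of_le_of_ne (Set.mem_Iic.1 ha.2) fun h => hz (by rw [← h]; exact ha.1)
  have hzb := lt_of_le_of_ne (Set.mem_Ici.1 hb.2) fun h => hz (by rw [h]; exact hb.1)
  obtain ⟨r, hr, h1, h2⟩ := hbtw _ ha.1 _ hb.1 (haz.trans hzb)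
  rcases le_total r z with h | h
  · exact absurd (le_csSup ba ⟨hr, h⟩) (not_le.2 h1)
  · exact absurd (csInf_le bb ⟨hr, h⟩) (not_le.2 h2)

variable {X : Type u} [MetricSpace X]

theorem BlumenthalAxioms.line_mem_range (hX : BlumenthalAxioms X) {f : X → Fin 3 → ℝ}
    (hf : ∀ q r, dist q r ^ 2 = (f q - f r) ⬝ᵥ (f q - f r)) (hcl : IsClosed (Set.range f))
    {A B : Fin 3 → ℝ} (hA : A ∈ Set.range f) (hB : B ∈ Set.range f) (t : ℝ) :
    A + t • (B - A) ∈ Set.range f := by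
  by_cases hAB : A = B
  · simpa [hAB] using hB
  obtain ⟨i, hi⟩ : ∃ i, B i - A i ≠ 0 := by
    by_contra h
    push Not at h
    exact hAB (funext fun i => (sub_eq_zero.1 (h i)).symm)
  let T : Set ℝ := (fun t : ℝ => A + t • (B - A)) ⁻¹' Set.range f
  have hinj : ∀ s t : ℝ, A + s • (B - A) = A + t • (B - A) → s = t := by
    intro s t h
    have := congrFun h i
    simp only [Pi.add_apply, Pi.smul_apply, Pi.sub_apply, smul_eq_mul] at this
    exact mul_right_cancel₀ hi (add_left_cancel this)
  -- Solving `f y = α • f x + (1 - α) • f z` for `f z` puts `z` at the parameter `t + α / (1 - α) *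
  -- (t - s)`, beyond `t` as seen from `s`.
  have hext : ∀ s ∈ T, ∀ t ∈ T, s ≠ t → ∃ c : ℝ, 0 < c ∧ t + c * (t - s) ∈ T := by
    rintro s ⟨x, hx⟩ t ⟨y, hy⟩ hst
    have hxy : x ≠ y := by
      rintro rfl
      exact hst (hinj _ _ (hx.symm.trans hy))
    obtain ⟨z, hz⟩ := hX.externally_convex x y hxy
    obtain ⟨α, h0, h1, h⟩ := exists_eq_of_metricBetween hz (hf _ _) (hf _ _) (hf _ _)
    have h1' : 0 < 1 - α := by linarith
    refine ⟨α / (1 - α), div_pos h0 h1', z, ?_⟩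
    have hzv : (1 - α) • f z = f y - α • f x := by rw [h]; module
    funext j
    have h' := congrFun hzv j
    simp only [hx, hy, Pi.add_apply, Pi.smul_apply, Pi.sub_apply, smul_eq_mul] at h' ⊢
    field_simp
    linarith
  have h0 : (0 : ℝ) ∈ T := by simpa [T] using hA
  have h1 : (1 : ℝ) ∈ T := by simpa [T] using hB
  suffices h : T = Set.univ by
    have ht : t ∈ T := h ▸ Set.mem_univ t
    exact ht
  refine eq_univ_of_forall_exists_between (hcl.preimage (by fun_prop)) ?_ ?_ ?_ ⟨0, h0⟩
  · rintro s ⟨x, hx⟩ t ⟨y, hy⟩ hst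
    have hxy : x ≠ y := by
      rintro rfl
      exact hst.ne (hinj _ _ (hx.symm.trans hy))
    obtain ⟨z, hz⟩ := hX.convex x y hxy
    obtain ⟨α, h0, h1, h⟩ := exists_eq_of_metricBetween hz (hf _ _) (hf _ _) (hf _ _)
    refine ⟨α * s + (1 - α) * t, ⟨z, ?_⟩, by nlinarith, by nlinarith⟩
    rw [h, hx, hy]
    module
  · intro s hs
    obtain ⟨r, hr, hrs⟩ : ∃ r ∈ T, r ≠ s := by
      by_cases h : s = 0
      · exact ⟨1, h1, by rw [h]; exact one_ne_zero⟩
      · exact ⟨0, h0, fun h' => h h'.symm⟩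
    rcases lt_or_gt_of_ne hrs with h | h
    · obtain ⟨c, hc, hm⟩ := hext r hr s hs hrs
      exact ⟨_, hm, by nlinarith [mul_pos hc (sub_pos.2 h)]⟩
    · exact ⟨r, hr, h⟩
  · intro s hs
    obtain ⟨r, hr, hrs⟩ : ∃ r ∈ T, r ≠ s := by
      by_cases h : s = 0
      · exact ⟨1, h1, by rw [h]; exact one_ne_zero⟩
      · exact ⟨0, h0, fun h' => h h'.symm⟩
    rcases lt_or_gt_of_ne hrs with h | h
    · exact ⟨r, hr, h⟩
    · obtain ⟨c, hc, hm⟩ := hext r hr s hs hrs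
      exact ⟨_, hm, by nlinarith [mul_pos hc (sub_pos.2 h)]⟩

theorem BlumenthalAxioms.isEuclidean [CompleteSpace X] (hX : BlumenthalAxioms X) :
    IsEuclidean X := by
  obtain ⟨f, p, hf, hT⟩ := hX.exists_coordinates
  have hiso : Isometry fun x => (WithLp.toLp 2 (f x) : EuclideanSpace ℝ (Fin 3)) := by
    refine Isometry.of_dist_eq fun x y => ?_
    rw [← sq_eq_sq₀ dist_nonneg dist_nonneg, hf, EuclideanSpace.dist_eq,
      Real.sq_sqrt (Finset.sum_nonneg fun i _ => sq_nonneg _)]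
    simp [dotProduct, Real.dist_eq, sq]
  have hcl : IsClosed (Set.range f) := by
    have h := hiso.isClosedEmbedding.isClosed_range.preimage
      (EuclideanSpace.equiv (Fin 3) ℝ).symm.continuous
    convert h using 1
    ext z
    constructor
    · rintro ⟨x, rfl⟩
      exact ⟨x, rfl⟩
    · rintro ⟨x, hx⟩
      exact ⟨x, congrArg WithLp.ofLp hx⟩
  have hline := fun {A B} hA hB t => hX.line_mem_range hf hcl (A := A) (B := B) hA hB t
  let S : Set (Fin 3 → ℝ) := {z | f (p 0) + z ∈ Set.range f}
  have hsmul : ∀ z ∈ S, ∀ t : ℝ, t • z ∈ S := by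
    intro z hz t
    have := hline ⟨p 0, rfl⟩ hz t
    rwa [add_sub_cancel_left] at this
  -- A sum is twice a midpoint, and the midpoint lies on the line through the two points.
  have hadd : ∀ z ∈ S, ∀ w ∈ S, z + w ∈ S := by
    intro z hz w hw
    have := hsmul _ (show (1 / 2 : ℝ) • (z + w) ∈ S by
      have h : f (p 0) + (1 / 2 : ℝ) • (z + w) = (f (p 0) + z) +
          (1 / 2 : ℝ) • ((f (p 0) + w) - (f (p 0) + z)) := by module
      have h' := hline hz hw (1 / 2)
      rwa [← h] at h') 2
    rwa [smul_smul, show (2 : ℝ) * (1 / 2) = 1 by norm_num, one_smul] at this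
  have hmem : ∀ i, f (p i) - f (p 0) ∈ S := fun i => ⟨p i, by abel⟩
  have hsurj : Function.Surjective f := by
    intro z
    obtain ⟨u, hu⟩ : ∃ u, u = f (p 1) - f (p 0) := ⟨_, rfl⟩
    obtain ⟨v, hv⟩ : ∃ v, v = f (p 2) - f (p 0) := ⟨_, rfl⟩
    obtain ⟨w, hw⟩ : ∃ w, w = f (p 3) - f (p 0) := ⟨_, rfl⟩
    have hS := hadd _ (hadd _ (hsmul _ (hmem 1) ((z - f (p 0)) ⬝ᵥ v ⨯₃ w)) _
      (hsmul _ (hmem 2) ((z - f (p 0)) ⬝ᵥ w ⨯₃ u))) _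
      (hsmul _ (hmem 3) ((z - f (p 0)) ⬝ᵥ u ⨯₃ v))
    rw [← hu, ← hv, ← hw] at hS hT
    have cramer : ((z - f (p 0)) ⬝ᵥ v ⨯₃ w) • u + ((z - f (p 0)) ⬝ᵥ w ⨯₃ u) • v +
        ((z - f (p 0)) ⬝ᵥ u ⨯₃ v) • w = (u ⬝ᵥ v ⨯₃ w) • (z - f (p 0)) := by
      funext i
      fin_cases i <;> simp [dotProduct, Fin.sum_univ_three, cross_apply] <;> ring
    rw [cramer] at hS
    have := hsmul _ hS (u ⬝ᵥ v ⨯₃ w)⁻¹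
    rw [smul_smul, inv_mul_cancel₀ hT, one_smul] at this
    have h : f (p 0) + (z - f (p 0)) ∈ Set.range f := this
    rwa [add_sub_cancel] at h
  refine ⟨IsometryEquiv.mk (Equiv.ofBijective _ ⟨hiso.injective, fun z => ?_⟩) hiso⟩
  obtain ⟨x, hx⟩ := hsurj (WithLp.ofLp z)
  exact ⟨x, by simp [hx]⟩

end Surjectivity

theorem mainTheorem1 {Θ : Type u} [CompleteBooleanAlgebra Θ] (W : RelationalWorld.{u, v} Θ)
    (e : W.HState) (hE : BlumenthalAxioms (W.GeometricSpace e)) :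
    IsEuclidean (W.GeometricSpace e) :=
  hE.isEuclidean
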